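/- Let $\tfrac12\le\rho<1$, let $S_0(x)=\rho x$ and $S_1(x)=\rho x+1-\rho$, and let $\mu_\rho$ be the unbiased Bernoulli convolution, i.e. the unique Borel probability measure on $\mathbb R$ with $\mu_\rho=\tfrac12\,\mu_\rho\circ S_0^{-1}+\tfrac12\,\mu_\rho\circ S_1^{-1}$. For a word $\sigma=(\sigma_1,\dots,\sigma_n)\in\{0,1\}^n$ put $S_\sigma=S_{\sigma_1}\circ\dots\circ S_{\sigma_n}$, and for $y\in[0,1]$ let $$\mathcal N_n(y)=\sum_{\sigma\in\{0,1\}^n:\ y\in S_\sigma([0,1])}2^{-n}.$$ Suppose that $\mu_\rho$ satisfies the asymptotically weak separation condition: there is a sequence $f(n)$ with $\frac{\log f(n)}{n}\to0$ such that for all $n\in\mathbb N$ and all $x\in[0,1]$ $$\#\{S_\sigma([0,1]):\sigma\in\{0,1\}^n,\ S_\sigma([0,1])\cap(x-\rho^n,x+\rho^n)\ne\emptyset\}\le f(n).$$ Then for every $x\in[0,1]$ the lower local dimension $$\underline{\dim}_{loc}\,\mu_\rho(x)=\liminf_{\epsilon\to0^+}\frac{\log\mu_\rho([x-\epsilon,x+\epsilon])}{\log\epsilon}$$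 satisfies the following lower bounds: - $\underline{\dim}_{loc}\,\mu_\rho(x)\ge 0.792021$ if $\rho\in[0.50,0.55]$; - $\underline{\dim}_{loc}\,\mu_\rho(x)\ge 0.825663$ if $\rho\in[0.55,0.60]$; - $\underline{\dim}_{loc}\,\mu_\rho(x)\ge 0.840348$ if $\rho\in[0.60,0.65]$; - $\underline{\dim}_{loc}\,\mu_\rho(x)\ge 0.824701$ if $\rho\in[0.65,0.70]$; - $\underline{\dim}_{loc}\,\mu_\rho(x)\ge 0.750984$ if $\rho\in[0.70,0.75]$; - $\underline{\dim}_{loc}\,\mu_\rho(x)\ge 0.635012$ if $\rho\in[0.75,0.80]$; - $\underline{\dim}_{loc}\,\mu_\rho(x)\ge 0.416226$ if $\rho\in[0.80,0.851]$. Moreover, for every $\rho\in[\tfrac12,1)$ as above and every $n\in\{1,\dots,10\}$, $$\underline{\dim}_{loc}\,\mu_\rho(x)\ \ge\ \frac{\log\bigl(\sup_{y\in[0,1]}\mathcal N_n(y)\bigr)}{n\log\rho}.$$ -/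

import Mathlib

open MeasureTheory Filter Topology
open scoped ENNReal

namespace BernoulliConv

/-- The two contractions `S₀ x = ρ x` and `S₁ x = ρ x + (1 - ρ)`. -/
noncomputable def S (ρ : ℝ) (j : Fin 2) (x : ℝ) : ℝ := ρ * x + (j : ℕ) * (1 - ρ)

/-- The composition `S_{σ₁} ∘ ⋯ ∘ S_{σₙ}` along a word `σ` of length `n`. -/
noncomputable def wordMap (ρ : ℝ) : (n : ℕ) → (Fin n → Fin 2) → ℝ → ℝ
  | 0, _ => id
  | n + 1, σ => S ρ (σ 0) ∘ wordMap ρ n (Fin.tail σ)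

/-- `μ` is the unbiased Bernoulli convolution with contraction factor `ρ`: a Borel probability
measure on `ℝ` with `μ = (1/2) μ ∘ S₀⁻¹ + (1/2) μ ∘ S₁⁻¹`. For `0 ≤ ρ < 1` exactly one measure has
this property; existence is `exists_isUnbiasedBernoulliConvolution` below. -/
def IsUnbiasedBernoulliConvolution (ρ : ℝ) (μ : Measure ℝ) : Prop :=
  IsProbabilityMeasure μ ∧
    μ = (1 / 2 : ℝ≥0∞) • μ.map (S ρ 0) + (1 / 2 : ℝ≥0∞) • μ.map (S ρ 1)

/-- The interval `S_σ([0,1])`. -/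
def wordInterval (ρ : ℝ) (n : ℕ) (σ : Fin n → Fin 2) : Set ℝ :=
  wordMap ρ n σ '' Set.Icc 0 1

/-- The asymptotically weak separation condition for the system `S₀, S₁`: there is a sequence
`f` with `log f(n) / n → 0` such that for every `n` and every `x ∈ [0,1]` at most `f n` distinct
intervals `S_σ([0,1])` with `|σ| = n` meet `(x - ρⁿ, x + ρⁿ)`. -/
def AsymptoticallyWSC (ρ : ℝ) : Prop :=
  ∃ f : ℕ → ℝ, Tendsto (fun n : ℕ => Real.log (f n) / n) atTop (𝓝 0) ∧
    ∀ n : ℕ, ∀ x ∈ Set.Icc (0 : ℝ) 1,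
      (Set.ncard {I : Set ℝ | (∃ σ : Fin n → Fin 2, wordInterval ρ n σ = I) ∧
        (I ∩ Set.Ioo (x - ρ ^ n) (x + ρ ^ n)).Nonempty} : ℝ) ≤ f n

open Classical in
/-- `𝒩_n(y)`: the sum of the weights `p_σ = 2⁻ⁿ` over all words `σ` of length `n` with
`y ∈ S_σ([0,1])`. -/
noncomputable def N (ρ : ℝ) (n : ℕ) (y : ℝ) : ℝ :=
  ∑ σ : Fin n → Fin 2 with y ∈ wordInterval ρ n σ, (1 / 2 : ℝ) ^ n

/-- The lower local dimension `liminf_{ε → 0⁺} log μ([x-ε,x+ε]) / log ε`, as an extended real. -/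
noncomputable def lowerLocalDim (μ : Measure ℝ) (x : ℝ) : EReal :=
  liminf (fun ε : ℝ =>
    ENNReal.log (μ (Set.Icc (x - ε) (x + ε))) / ((Real.log ε : ℝ) : EReal)) (𝓝[>] 0)

/-- A sequence with a letter put in front. -/
def cons (b : Fin 2) (ω : ℕ → Fin 2) : ℕ → Fin 2
  | 0 => b
  | n + 1 => ω n

theorem measurable_cons (b : Fin 2) : Measurable (cons b) := by
  refine measurable_pi_lambda _ fun n => ?_
  cases n with
  | zero => exact measurable_const
  | succ n => exact measurable_pi_apply n

/-- The fair coin. -/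
noncomputable def coin : Measure (Fin 2) :=
  (1 / 2 : ℝ≥0∞) • Measure.dirac 0 + (1 / 2 : ℝ≥0∞) • Measure.dirac 1

instance : IsProbabilityMeasure coin := ⟨by
  simp [coin, ENNReal.inv_two_add_inv_two]⟩

theorem coin_sequence_eq :
    (1 / 2 : ℝ≥0∞) • (Measure.infinitePi fun _ : ℕ => coin).map (cons 0) +
      (1 / 2 : ℝ≥0∞) • (Measure.infinitePi fun _ : ℕ => coin).map (cons 1) =
    Measure.infinitePi fun _ : ℕ => coin := by
  classical
  apply Measure.eq_infinitePi
  intro s t ht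
  obtain ⟨K, hK⟩ : ∃ K, s ⊆ Finset.range (K + 1) :=
    ⟨s.sup id, fun i hi => Finset.mem_range.2 (Nat.lt_succ_of_le (Finset.le_sup (f := id) hi))⟩
  set u : ℕ → Set (Fin 2) := fun i => if i ∈ s then t i else Set.univ with hu
  have hpi : Set.pi (s : Set ℕ) t = Set.pi (Finset.range (K + 1) : Set ℕ) u := by
    ext ω
    simp only [Set.mem_pi, Finset.mem_coe]
    constructor
    · intro h i _
      by_cases his : i ∈ s
      · simpa [hu, his] using h i his
      · simp [hu, his]
    · intro h i hi
      simpa [hu, hi] using h i (hK hi)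
  have hprod : ∏ i ∈ s, coin (t i) = ∏ i ∈ Finset.range (K + 1), coin (u i) := by
    rw [← Finset.prod_subset hK (f := fun i => coin (u i))]
    · exact Finset.prod_congr rfl fun i hi => by simp [hu, hi]
    · intro i _ hi
      simp [hu, hi]
  have hmap (b : Fin 2) : (Measure.infinitePi fun _ : ℕ => coin).map (cons b)
      (Set.pi (Finset.range (K + 1) : Set ℕ) u) =
      (u 0).indicator 1 b * ∏ i ∈ Finset.range K, coin (u (i + 1)) := by
    have hm : MeasurableSet (Set.pi (Finset.range (K + 1) : Set ℕ) u) :=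
      MeasurableSet.pi (Finset.countable_toSet _) fun _ _ => MeasurableSet.of_discrete
    rw [Measure.map_apply (measurable_cons b) hm]
    by_cases hb : b ∈ u 0
    · have : cons b ⁻¹' Set.pi (Finset.range (K + 1) : Set ℕ) u =
          Set.pi (Finset.range K : Set ℕ) (fun i => u (i + 1)) := by
        ext ω
        simp only [Set.mem_preimage, Set.mem_pi, Finset.mem_coe, Finset.mem_range]
        constructor
        · intro h i hi
          exact h (i + 1) (by omega)
        · intro h i hi
          cases i with
          | zero => exact hb
          | succ i => exact h i (by omega)
      rw [this, Measure.infinitePi_pi _ fun _ _ => MeasurableSet.of_discrete]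
      simp [hb]
    · have : cons b ⁻¹' Set.pi (Finset.range (K + 1) : Set ℕ) u = ∅ := by
        ext ω
        simp only [Set.mem_preimage, Set.mem_pi, Finset.mem_coe, Finset.mem_range,
          Set.mem_empty_iff_false, iff_false]
        intro h
        exact hb (h 0 (by omega))
      rw [this]
      simp [hb]
  rw [hpi, hprod, Finset.prod_range_succ']
  simp only [Measure.add_apply, Measure.smul_apply, hmap, smul_eq_mul]
  have hc : coin (u 0) = 1 / 2 * (u 0).indicator 1 0 + 1 / 2 * (u 0).indicator 1 1 := by
    simp [coin, Measure.dirac_apply' _ (MeasurableSet.of_discrete : MeasurableSet (u 0))]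
  rw [hc]
  ring

/-- For `0 ≤ ρ < 1` the unbiased Bernoulli convolution exists: it is the law of
`∑ (1 - ρ) ρⁱ ωᵢ` for independent fair coin tosses `ωᵢ ∈ {0, 1}`. -/
theorem exists_isUnbiasedBernoulliConvolution (ρ : ℝ) (h0 : 0 ≤ ρ) (h1 : ρ < 1) :
    ∃ μ : Measure ℝ, IsUnbiasedBernoulliConvolution ρ μ := by
  set P := Measure.infinitePi fun _ : ℕ => coin with hP
  set X : (ℕ → Fin 2) → ℝ := fun ω => ∑' i, (1 - ρ) * ρ ^ i * ((ω i : ℕ) : ℝ) with hX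
  have hs (ω : ℕ → Fin 2) : Summable fun i => (1 - ρ) * ρ ^ i * ((ω i : ℕ) : ℝ) := by
    refine Summable.of_nonneg_of_le (fun i => ?_) (fun i => ?_)
      ((summable_geometric_of_lt_one h0 h1).mul_left (1 - ρ))
    · have := sub_nonneg.2 h1.le
      positivity
    · have h2 : ((ω i : ℕ) : ℝ) ≤ 1 := by exact_mod_cast Nat.lt_succ_iff.1 (ω i).2
      exact mul_le_of_le_one_right (mul_nonneg (sub_nonneg.2 h1.le) (pow_nonneg h0 i)) h2
  have hXm : Measurable X := by
    refine measurable_of_tendsto_metrizable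
      (f := fun n ω => ∑ i ∈ Finset.range n, (1 - ρ) * ρ ^ i * ((ω i : ℕ) : ℝ)) (fun n => ?_) ?_
    · refine Finset.measurable_sum _ fun i _ => Measurable.const_mul ?_ _
      exact (Measurable.of_discrete (f := fun b : Fin 2 => ((b : ℕ) : ℝ))).comp
        (measurable_pi_apply i)
    · exact tendsto_pi_nhds.2 fun ω => (hs ω).hasSum.tendsto_sum_nat
  have hSm (b : Fin 2) : Measurable (S ρ b) := by
    unfold S
    fun_prop
  have hcons (b : Fin 2) : X ∘ cons b = S ρ b ∘ X := by
    funext ω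
    simp only [Function.comp, hX, S]
    rw [(hs (cons b ω)).tsum_eq_zero_add, ← tsum_mul_left]
    simp only [cons, pow_zero, pow_succ]
    rw [add_comm]
    congr 1
    · exact tsum_congr fun i => by ring
    · ring
  have : IsProbabilityMeasure (P.map X) := Measure.isProbabilityMeasure_map hXm.aemeasurable
  refine ⟨P.map X, this, ?_⟩
  have key := congrArg (Measure.map X) coin_sequence_eq
  rw [Measure.map_add _ _ hXm, Measure.map_smul, Measure.map_smul,
    Measure.map_map hXm (measurable_cons 0), Measure.map_map hXm (measurable_cons 1),
    hcons, hcons, ← Measure.map_map (hSm 0) hXm, ← Measure.map_map (hSm 1) hXm] at key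
  exact key.symm

end BernoulliConv

namespace BernoulliConv

/-! The argument separates a geometric bound from a growth estimate. Since `μ` is carried by
`[0,1]`, iterating self-similarity bounds `μ A` by the weight of the level-`n` words whose interval
meets `A`. Words with the same interval `I` all count towards `N ρ n y` for any `y ∈ I`, so each
distinct interval contributes at most `sup N ρ n`. For `A = (x - ρⁿ, x + ρⁿ)` the separation
condition leaves only subexponentially many intervals. Hence `N ρ n ≤ C (ρ^d)ⁿ` forces lower local
dimension at least `d` (`le_lowerLocalDim_of_N_le`).

It remains to bound `N`. Splitting off the first letter gives `N ρ (n+1) = T (N ρ n)` for the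
positive operator `(T g)(y) = (g(y/ρ) + g((y-(1-ρ))/ρ))/2`, starting from the indicator of `[0,1]`.
Submultiplicativity of the suprema yields the bound by `log (sup 𝒩_n) / (n log ρ)`. For the
numerical bounds, a function `g ≥ 1` on `[0,1]` with `T g ≤ λ g` there gives `N ρ n ≤ λⁿ g`.
Integer-valued step functions serve as `g`, each checked by integer arithmetic for a whole interval
of `ρ` at once. -/

theorem continuous_S (ρ : ℝ) (j : Fin 2) : Continuous (S ρ j) := by
  unfold S
  fun_prop

/-! ### Recursion and submultiplicativity for `N`. -/

theorem mem_wordInterval_zero {ρ y : ℝ} {σ : Fin 0 → Fin 2} :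
    y ∈ wordInterval ρ 0 σ ↔ y ∈ Set.Icc (0 : ℝ) 1 := by
  simp [wordInterval, wordMap]

theorem mem_wordInterval_cons {ρ : ℝ} (h : ρ ≠ 0) {n : ℕ} {y : ℝ} {j : Fin 2}
    {σ : Fin n → Fin 2} :
    y ∈ wordInterval ρ (n + 1) (Fin.cons j σ) ↔
      (y - (j : ℕ) * (1 - ρ)) / ρ ∈ wordInterval ρ n σ := by
  simp only [wordInterval, wordMap, Set.mem_image, Function.comp, Fin.cons_zero, Fin.tail_cons, S]
  refine exists_congr fun z => and_congr_right fun _ => ?_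
  rw [eq_div_iff h]
  constructor <;> intro e <;> linarith

theorem sum_words_succ {M : Type*} [AddCommMonoid M] {n : ℕ} (F : (Fin (n + 1) → Fin 2) → M) :
    ∑ σ, F σ = ∑ σ : Fin n → Fin 2, F (Fin.cons 0 σ) + ∑ σ : Fin n → Fin 2, F (Fin.cons 1 σ) := by
  rw [← (Fin.consEquiv fun _ => Fin 2).sum_comp, Fintype.sum_prod_type, Fin.sum_univ_two]
  rfl

theorem N_zero (ρ y : ℝ) : N ρ 0 y = (Set.Icc (0 : ℝ) 1).indicator 1 y := by
  classical
  simp only [N, mem_wordInterval_zero, pow_zero, Finset.sum_filter, Set.indicator_apply]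
  simp

theorem N_succ {ρ : ℝ} (h : ρ ≠ 0) (n : ℕ) (y : ℝ) :
    N ρ (n + 1) y = (N ρ n (y / ρ) + N ρ n ((y - (1 - ρ)) / ρ)) / 2 := by
  classical
  simp only [N, Finset.sum_filter, sum_words_succ, mem_wordInterval_cons h]
  simp only [Fin.val_zero, Fin.val_one, Nat.cast_zero, Nat.cast_one, zero_mul, one_mul, sub_zero]
  rw [add_div, Finset.sum_div, Finset.sum_div]
  congr 1 <;> refine Finset.sum_congr rfl fun σ _ => ?_ <;> split_ifs <;> ring

theorem N_nonneg (ρ : ℝ) (n : ℕ) (y : ℝ) : 0 ≤ N ρ n y :=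
  Finset.sum_nonneg fun _ _ => by positivity

theorem N_le_one {ρ : ℝ} (h : ρ ≠ 0) (n : ℕ) (y : ℝ) : N ρ n y ≤ 1 := by
  induction n generalizing y with
  | zero =>
    rw [N_zero]
    exact Set.indicator_le_self' (by simp) y
  | succ n ih =>
    rw [N_succ h]
    linarith [ih (y / ρ), ih ((y - (1 - ρ)) / ρ)]

/-- The sum `𝒩_n` vanishes off `[0,1]`. -/
theorem N_eq_zero {ρ : ℝ} (h0 : 0 < ρ) (h1 : ρ ≤ 1) (n : ℕ) {y : ℝ}
    (hy : y ∉ Set.Icc (0 : ℝ) 1) : N ρ n y = 0 := by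
  induction n generalizing y with
  | zero => simp [N_zero, hy]
  | succ n ih =>
    rw [N_succ h0.ne', ih, ih]
    · simp
    · contrapose! hy
      rw [Set.mem_Icc, le_div_iff₀ h0, div_le_one h0] at hy
      constructor <;> linarith [hy.1, hy.2]
    · contrapose! hy
      rw [Set.mem_Icc, le_div_iff₀ h0, div_le_one h0] at hy
      constructor <;> linarith [hy.1, hy.2]

/-- The operator is positive and linear: applying it `m` times to `N ρ n ≤ s · 1_[0,1]` gives the
claim. -/
theorem N_add_le {ρ : ℝ} (h0 : 0 < ρ) (h1 : ρ ≤ 1) {n : ℕ} {s : ℝ} (hs : ∀ y, N ρ n y ≤ s)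
    (m : ℕ) (y : ℝ) : N ρ (m + n) y ≤ N ρ m y * s := by
  induction m generalizing y with
  | zero =>
    rw [Nat.zero_add, N_zero]
    by_cases hy : y ∈ Set.Icc (0 : ℝ) 1
    · simpa [hy] using hs y
    · simp [hy, N_eq_zero h0 h1 n hy]
  | succ m ih =>
    rw [Nat.add_right_comm, N_succ h0.ne', N_succ h0.ne']
    linarith [ih (y / ρ), ih ((y - (1 - ρ)) / ρ)]

theorem N_mul_add_le {ρ : ℝ} (h0 : 0 < ρ) (h1 : ρ ≤ 1) {n : ℕ} {s : ℝ} (hs : ∀ y, N ρ n y ≤ s)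
    (k r : ℕ) (y : ℝ) : N ρ (n * k + r) y ≤ s ^ k := by
  have hs0 : 0 ≤ s := (N_nonneg ρ n 0).trans (hs 0)
  induction k generalizing y with
  | zero => simpa using N_le_one h0.ne' r y
  | succ k ih =>
    have := N_add_le h0 h1 hs (n * k + r) y
    rw [show n * (k + 1) + r = n * k + r + n by ring, pow_succ]
    exact this.trans (mul_le_mul_of_nonneg_right (ih y) hs0)

theorem N_le_iSup {ρ : ℝ} (h0 : 0 < ρ) (h1 : ρ ≤ 1) (n : ℕ) (y : ℝ) :
    N ρ n y ≤ ⨆ z : Set.Icc (0 : ℝ) 1, N ρ n z := by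
  have hb : BddAbove (Set.range fun z : Set.Icc (0 : ℝ) 1 => N ρ n z) :=
    ⟨1, by rintro _ ⟨z, rfl⟩; exact N_le_one h0.ne' n z⟩
  by_cases hy : y ∈ Set.Icc (0 : ℝ) 1
  · exact le_ciSup hb ⟨y, hy⟩
  · rw [N_eq_zero h0 h1 n hy]
    exact (N_nonneg ρ n 0).trans (le_ciSup hb ⟨0, by simp⟩)

/-- The word `0…0` fixes `0`. This makes the supremum positive, so that its logarithm is genuine. -/
theorem N_zero_right_pos {ρ : ℝ} (h0 : 0 < ρ) (n : ℕ) : 0 < N ρ n 0 := by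
  induction n with
  | zero => simp [N_zero]
  | succ n ih =>
    rw [N_succ h0.ne', zero_div]
    linarith [N_nonneg ρ n ((0 - (1 - ρ)) / ρ)]

/-! ### Self-similarity and support of the measure. -/

theorem IsUnbiasedBernoulliConvolution.apply {ρ : ℝ} {μ : Measure ℝ}
    (hμ : IsUnbiasedBernoulliConvolution ρ μ) {A : Set ℝ} (hA : MeasurableSet A) :
    μ A = 1 / 2 * μ (S ρ 0 ⁻¹' A) + 1 / 2 * μ (S ρ 1 ⁻¹' A) := by
  conv_lhs => rw [hμ.2]
  rw [Measure.add_apply, Measure.smul_apply, Measure.smul_apply,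
    Measure.map_apply (continuous_S ρ 0).measurable hA,
    Measure.map_apply (continuous_S ρ 1).measurable hA, smul_eq_mul, smul_eq_mul]

/-- The self-similarity relation iterated `n` times. -/
theorem IsUnbiasedBernoulliConvolution.apply_eq_sum {ρ : ℝ} {μ : Measure ℝ}
    (hμ : IsUnbiasedBernoulliConvolution ρ μ) (n : ℕ) {A : Set ℝ} (hA : MeasurableSet A) :
    μ A = ∑ σ : Fin n → Fin 2, (1 / 2 : ℝ≥0∞) ^ n * μ (wordMap ρ n σ ⁻¹' A) := by
  induction n generalizing A with
  | zero => simp [wordMap]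
  | succ n ih =>
    rw [hμ.apply hA, ih ((continuous_S ρ 0).measurable hA), ih ((continuous_S ρ 1).measurable hA),
      sum_words_succ, Finset.mul_sum, Finset.mul_sum]
    simp only [wordMap, Fin.cons_zero, Fin.tail_cons, Set.preimage_comp, pow_succ]
    congr 1 <;> refine Finset.sum_congr rfl fun σ _ => ?_ <;> ring

theorem abs_S_sub_half_le {ρ : ℝ} (h0 : 0 ≤ ρ) (h1 : ρ ≤ 1) (j : Fin 2) (x : ℝ) :
    |S ρ j x - 1 / 2| ≤ ρ * |x - 1 / 2| + (1 - ρ) / 2 := by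
  have : S ρ j x - 1 / 2 = ρ * (x - 1 / 2) + (2 * (j : ℕ) - 1) * ((1 - ρ) / 2) := by
    unfold S
    ring
  rw [this]
  refine (abs_add_le _ _).trans (add_le_add ?_ ?_)
  · rw [abs_mul, abs_of_nonneg h0]
  · rw [abs_mul, abs_of_nonneg (by linarith : (0 : ℝ) ≤ (1 - ρ) / 2)]
    refine mul_le_of_le_one_left (by linarith) ?_
    fin_cases j <;> norm_num

/-- The Bernoulli convolution is carried by `[0,1]`. -/
theorem IsUnbiasedBernoulliConvolution.compl_Icc {ρ : ℝ} (h0 : 0 < ρ) (h1 : ρ < 1)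
    {μ : Measure ℝ} (hμ : IsUnbiasedBernoulliConvolution ρ μ) :
    μ (Set.Icc (0 : ℝ) 1)ᶜ = 0 := by
  have := hμ.1
  let T : ℝ → Set ℝ := fun R => {x | R < |x - 1 / 2|}
  have hTm (R : ℝ) : MeasurableSet (T R) :=
    measurableSet_lt measurable_const (by fun_prop)
  -- Both maps shrink the excess of `|x - 1/2|` over `1/2` by at least the factor `ρ`. Iterating
  -- pushes the mass outside `[0,1]` to infinity, where a finite measure has none.
  have hstep (δ : ℝ) : μ (T (1 / 2 + δ)) ≤ μ (T (1 / 2 + δ / ρ)) := by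
    have hsub (j : Fin 2) : S ρ j ⁻¹' T (1 / 2 + δ) ⊆ T (1 / 2 + δ / ρ) := by
      intro x hx
      have hx' : 1 / 2 + δ < |S ρ j x - 1 / 2| := hx
      have := abs_S_sub_half_le h0.le h1.le j x
      change 1 / 2 + δ / ρ < |x - 1 / 2|
      rw [← mul_lt_mul_iff_right₀ h0, mul_add, mul_div_cancel₀ _ h0.ne']
      linarith
    rw [hμ.apply (hTm _)]
    calc _ ≤ 1 / 2 * μ (T (1 / 2 + δ / ρ)) + 1 / 2 * μ (T (1 / 2 + δ / ρ)) := by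
          gcongr <;> exact hsub _
      _ = μ (T (1 / 2 + δ / ρ)) := by
          rw [← add_mul, one_div, ENNReal.inv_two_add_inv_two, one_mul]
  have hiter (δ : ℝ) (k : ℕ) : μ (T (1 / 2 + δ)) ≤ μ (T (1 / 2 + δ / ρ ^ k)) := by
    induction k with
    | zero => simp
    | succ k ih => exact ih.trans ((hstep _).trans_eq (by rw [div_div, pow_succ]))
  have hzero (δ : ℝ) (hδ : 0 < δ) : μ (T (1 / 2 + δ)) = 0 := by
    have hlim : Tendsto (fun R : ℝ => μ (T R)) atTop (𝓝 0) := by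
      have hanti : Antitone T := fun R R' h x hx => lt_of_le_of_lt h hx
      have := tendsto_measure_iInter_atTop (μ := μ) (s := T)
        (fun R => (hTm R).nullMeasurableSet) hanti ⟨0, measure_ne_top _ _⟩
      have he : ⋂ R, T R = ∅ := by
        refine Set.eq_empty_of_forall_notMem fun x hx => ?_
        exact lt_irrefl |x - 1 / 2| (Set.mem_iInter.1 hx |x - 1 / 2|)
      simpa [he, Function.comp_def] using this
    have hgrow : Tendsto (fun k : ℕ => 1 / 2 + δ / ρ ^ k) atTop atTop := by
      refine tendsto_atTop_add_const_left _ _ ?_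
      simp only [div_eq_mul_inv, ← inv_pow]
      exact (tendsto_pow_atTop_atTop_of_one_lt ((one_lt_inv₀ h0).2 h1)).const_mul_atTop hδ
    exact le_antisymm (ge_of_tendsto' (hlim.comp hgrow) (hiter δ)) zero_le
  have hcover : (Set.Icc (0 : ℝ) 1)ᶜ ⊆ ⋃ k : ℕ, T (1 / 2 + 1 / ((k : ℝ) + 1)) := by
    intro x hx
    have hx' : 0 < |x - 1 / 2| - 1 / 2 := by
      by_contra! h
      exact hx ⟨by linarith [(abs_le.1 (sub_nonpos.1 h)).1],
        by linarith [(abs_le.1 (sub_nonpos.1 h)).2]⟩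
    obtain ⟨k, hk⟩ := exists_nat_one_div_lt hx'
    exact Set.mem_iUnion.2 ⟨k, lt_sub_iff_add_lt'.1 (by linarith : 1 / ((k : ℝ) + 1) < |x - 1 / 2| - 1 / 2)⟩
  exact measure_mono_null hcover (measure_iUnion_null fun k => hzero _ (by positivity))

/-! ### From bounds on `N` to local dimension. -/

theorem wordInterval_nonempty (ρ : ℝ) (n : ℕ) (σ : Fin n → Fin 2) :
    (wordInterval ρ n σ).Nonempty :=
  (Set.nonempty_Icc.2 zero_le_one).image _

/-- A Borel set has measure at most the number of distinct intervals of level `n` meeting it times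
the supremum of `𝒩_n`. -/
theorem IsUnbiasedBernoulliConvolution.apply_le {ρ : ℝ} (h0 : 0 < ρ) (h1 : ρ < 1)
    {μ : Measure ℝ} (hμ : IsUnbiasedBernoulliConvolution ρ μ) {n : ℕ} {s : ℝ}
    (hs : ∀ y, N ρ n y ≤ s) {A : Set ℝ} (hA : MeasurableSet A) :
    μ A ≤ ENNReal.ofReal (Set.ncard {I : Set ℝ | (∃ σ : Fin n → Fin 2, wordInterval ρ n σ = I) ∧
      (I ∩ A).Nonempty} * s) := by
  classical
  have := hμ.1
  set W : Finset (Fin n → Fin 2) := {σ | (wordInterval ρ n σ ∩ A).Nonempty} with hW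
  have hbound (σ : Fin n → Fin 2) :
      μ (wordMap ρ n σ ⁻¹' A) ≤ if (wordInterval ρ n σ ∩ A).Nonempty then 1 else 0 := by
    split_ifs with h
    · exact prob_le_one
    · refine (measure_mono fun z hz => ?_).trans_eq (hμ.compl_Icc h0 h1)
      exact fun hz' => h ⟨_, ⟨z, hz', rfl⟩, hz⟩
  have hset : {I : Set ℝ | (∃ σ : Fin n → Fin 2, wordInterval ρ n σ = I) ∧ (I ∩ A).Nonempty} =
      (W.image (wordInterval ρ n) : Set (Set ℝ)) := by
    ext I
    simp only [Set.mem_ofPred_eq, hW, Finset.coe_image, Finset.coe_filter, Finset.mem_univ,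
      true_and, Set.mem_image]
    constructor
    · rintro ⟨⟨σ, rfl⟩, h⟩
      exact ⟨σ, h, rfl⟩
    · rintro ⟨σ, h, rfl⟩
      exact ⟨⟨σ, rfl⟩, h⟩
  -- Group the words by their interval; one point `y` of the interval lies in the intervals of the
  -- whole group, whose weight is therefore at most `N ρ n y`.
  have hsum : ∑ σ ∈ W, (1 / 2 : ℝ) ^ n ≤ (W.image (wordInterval ρ n)).card * s := by
    rw [← Finset.sum_fiberwise_of_maps_to (t := W.image (wordInterval ρ n))
      fun σ h => Finset.mem_image_of_mem _ h, ← nsmul_eq_mul]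
    refine Finset.sum_le_card_nsmul _ _ _ fun I hI => ?_
    obtain ⟨τ, -, rfl⟩ := Finset.mem_image.1 hI
    obtain ⟨y, hy⟩ := wordInterval_nonempty ρ n τ
    refine le_trans ?_ (hs y)
    refine Finset.sum_le_sum_of_subset_of_nonneg (fun σ hσ => ?_) fun _ _ _ => by positivity
    have := (Finset.mem_filter.1 hσ).2
    simpa [this] using hy
  rw [hset, Set.ncard_coe_finset]
  refine le_trans ?_ (ENNReal.ofReal_le_ofReal hsum)
  rw [hμ.apply_eq_sum n hA, ENNReal.ofReal_sum_of_nonneg fun _ _ => by positivity,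
    hW, Finset.sum_filter]
  refine Finset.sum_le_sum fun σ _ => (mul_le_mul_right (hbound σ) _).trans_eq ?_
  rw [mul_ite, mul_one, mul_zero, ENNReal.ofReal_pow (by positivity),
    ENNReal.ofReal_div_of_pos two_pos]
  simp

/-- Exponential bounds on `𝒩_n` turn into bounds on the lower local dimension. -/
theorem le_lowerLocalDim_of_N_le {ρ : ℝ} (h0 : 0 < ρ) (h1 : ρ < 1) {μ : Measure ℝ}
    (hμ : IsUnbiasedBernoulliConvolution ρ μ) (hsep : AsymptoticallyWSC ρ) {x : ℝ}
    (hx : x ∈ Set.Icc (0 : ℝ) 1) {C d : ℝ} (hC : 0 < C)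
    (hN : ∀ n y, N ρ n y ≤ C * (ρ ^ d) ^ n) : (d : EReal) ≤ lowerLocalDim μ x := by
  obtain ⟨f, hf, hfle⟩ := hsep
  have hlog : Real.log ρ < 0 := Real.log_neg h0 h1
  -- Truncation at `1` makes the factor positive with nonnegative logarithm and keeps it
  -- subexponential.
  set f' : ℕ → ℝ := fun m => max (f m) 1 with hf'
  have hf'lim : Tendsto (fun m : ℕ => Real.log (f' m) / m) atTop (𝓝 0) := by
    refine squeeze_zero (fun m => div_nonneg (Real.log_nonneg (le_max_right _ _)) m.cast_nonneg)
      (fun m => ?_) (by simpa using hf.abs)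
    rw [abs_div, Nat.abs_cast]
    gcongr
    rcases le_total (f m) 1 with h | h
    · simp [hf', h]
    · simp [hf', h, le_abs_self]
  refine le_of_forall_lt_imp_le_of_dense fun t' ht' => ?_
  induction t' with
  | bot => exact bot_le
  | top => exact absurd ht' (by simp)
  | coe t =>
  have htd : t < d := by exact_mod_cast ht'
  -- The gap `(t - d) m log ρ` is positive and linear in `m`, so it absorbs the other terms. The
  -- term `2 * |t| * log ρ` pays for knowing `log ε` only between `(m + 2) log ρ` and `m log ρ`.
  have hev : ∀ᶠ m : ℕ in atTop,
      Real.log (f' m) + Real.log C + d * m * Real.log ρ ≤ t * m * Real.log ρ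
        + 2 * |t| * Real.log ρ := by
    have hlim : Tendsto (fun m : ℕ => Real.log (f' m) / m
        + (Real.log C - 2 * |t| * Real.log ρ) / m) atTop (𝓝 0) := by
      simpa using hf'lim.add (tendsto_const_div_atTop_nhds_zero_nat
        (Real.log C - 2 * |t| * Real.log ρ))
    have hpos : 0 < (t - d) * Real.log ρ := mul_pos_of_neg_of_neg (by linarith) hlog
    filter_upwards [hlim.eventually_lt_const hpos, eventually_gt_atTop 0] with m hm hm0
    have hm0' : (0 : ℝ) < m := by exact_mod_cast hm0
    rw [← add_div, div_lt_iff₀ hm0'] at hm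
    linarith
  obtain ⟨m₀, hm₀⟩ := eventually_atTop.1 hev
  refine le_liminf_of_le (by isBoundedDefault) ?_
  filter_upwards [Ioo_mem_nhdsGT (pow_pos h0 (m₀ + 2))] with ε hε
  obtain ⟨hε0, hεm⟩ := hε
  have hεlt : ε < ρ := hεm.trans_le (pow_le_of_le_one h0.le h1.le (by simp))
  -- Using `ε / ρ` gives `ρ^(m+2) < ε ≤ ρ^(m+1) < ρ^m`; the last strict inequality fits the closed
  -- interval into the open one.
  obtain ⟨m, hlo, hhi⟩ := exists_nat_pow_near_of_lt_one (div_pos hε0 h0)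
    ((div_le_one h0).2 hεlt.le) h0 h1
  rw [lt_div_iff₀ h0, ← pow_succ] at hlo
  rw [div_le_iff₀ h0, ← pow_succ] at hhi
  have hεm' : ε < ρ ^ m := hhi.trans_lt (pow_lt_pow_right_of_lt_one₀ h0 h1 (Nat.lt_succ_self m))
  have hmm : m₀ ≤ m := by
    have := (pow_lt_pow_iff_right_of_lt_one₀ h0 h1).1 (hlo.trans hεm)
    omega
  have hlogε : Real.log ε < 0 := Real.log_neg hε0 (hεlt.trans h1)
  have hlogle : Real.log ε ≤ m * Real.log ρ := by
    rw [← Real.log_pow]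
    exact Real.log_le_log hε0 hεm'.le
  have hlogge : m * Real.log ρ + 2 * Real.log ρ ≤ Real.log ε := by
    have := Real.log_le_log (pow_pos h0 _) hlo.le
    rw [Real.log_pow] at this
    push_cast at this
    linarith
  have hf'pos : 0 < f' m := zero_lt_one.trans_le (le_max_right _ _)
  have hpow : 0 < ρ ^ d := Real.rpow_pos_of_pos h0 d
  have hmeas : μ (Set.Icc (x - ε) (x + ε)) ≤ ENNReal.ofReal (f' m * (C * (ρ ^ d) ^ m)) := by
    calc μ (Set.Icc (x - ε) (x + ε)) ≤ μ (Set.Ioo (x - ρ ^ m) (x + ρ ^ m)) :=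
          measure_mono fun z hz => ⟨by linarith [hz.1], by linarith [hz.2]⟩
      _ ≤ _ := hμ.apply_le h0 h1 (hN m) measurableSet_Ioo
      _ ≤ _ := by
          apply ENNReal.ofReal_le_ofReal
          gcongr
          exact (hfle m x hx).trans (le_max_left _ _)
  have hreal : Real.log (f' m * (C * (ρ ^ d) ^ m)) ≤ t * Real.log ε := by
    rw [Real.log_mul hf'pos.ne' (by positivity), Real.log_mul hC.ne' (by positivity),
      Real.log_pow, Real.log_rpow h0]
    have := hm₀ m hmm
    rcases le_total 0 t with h | h
    · rw [abs_of_nonneg h] at this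
      nlinarith
    · rw [abs_of_nonpos h] at this
      nlinarith
  have hcneg : ((Real.log ε : ℝ) : EReal) ≤ 0 := by exact_mod_cast hlogε.le
  have hE : ENNReal.log (μ (Set.Icc (x - ε) (x + ε))) ≤ ((t * Real.log ε : ℝ) : EReal) := by
    refine (ENNReal.log_le_log hmeas).trans ?_
    rw [ENNReal.log_ofReal_of_pos (by positivity)]
    exact_mod_cast hreal
  refine le_trans (le_of_eq ?_) (EReal.div_le_div_right_of_nonpos hcneg hE)
  rw [← EReal.coe_div, mul_div_cancel_right₀ _ hlogε.ne]

/-- With `r` the `n`-th root of `s = sup N ρ n`, submultiplicativity gives `N ρ m ≤ s⁻¹ r^m` for all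
`m`; the factor `s⁻¹` covers the remainder of `m` modulo `n`. -/
theorem log_iSup_N_le_lowerLocalDim {ρ : ℝ} (h0 : 0 < ρ) (h1 : ρ < 1) {μ : Measure ℝ}
    (hμ : IsUnbiasedBernoulliConvolution ρ μ) (hsep : AsymptoticallyWSC ρ) {x : ℝ}
    (hx : x ∈ Set.Icc (0 : ℝ) 1) {n : ℕ} (hn : n ≠ 0) :
    ((Real.log (⨆ y : Set.Icc (0 : ℝ) 1, N ρ n y) / (n * Real.log ρ) : ℝ) : EReal) ≤
      lowerLocalDim μ x := by
  set s := ⨆ y : Set.Icc (0 : ℝ) 1, N ρ n y with hs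
  have hs0 : 0 < s := (N_zero_right_pos h0 n).trans_le (N_le_iSup h0 h1.le n 0)
  have hs1 : s ≤ 1 := by
    have : Nonempty (Set.Icc (0 : ℝ) 1) := ⟨⟨0, by simp⟩⟩
    exact ciSup_le fun y => N_le_one h0.ne' n y
  have hlog : Real.log ρ < 0 := Real.log_neg h0 h1
  have hn' : (n : ℝ) ≠ 0 := by exact_mod_cast hn
  set r := ρ ^ (Real.log s / (n * Real.log ρ)) with hr
  have hr0 : 0 < r := Real.rpow_pos_of_pos h0 _
  have hrn : r ^ n = s := by
    apply Real.log_injOn_pos (Set.mem_Ioi.2 (pow_pos hr0 n)) (Set.mem_Ioi.2 hs0)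
    rw [Real.log_pow, hr, Real.log_rpow h0, ← div_div, div_mul_cancel₀ _ hlog.ne,
      mul_div_cancel₀ _ hn']
  have hr1 : r ≤ 1 := by
    by_contra! h
    exact absurd (one_lt_pow₀ h hn) (by rw [hrn]; exact hs1.not_gt)
  refine le_lowerLocalDim_of_N_le h0 h1 hμ hsep hx (inv_pos.2 hs0) fun m y => ?_
  have hmod := Nat.div_add_mod m n
  have hlt := Nat.mod_lt m (Nat.pos_of_ne_zero hn)
  calc N ρ m y = N ρ (n * (m / n) + m % n) y := by rw [hmod]
    _ ≤ s ^ (m / n) := N_mul_add_le h0 h1.le (N_le_iSup h0 h1.le n) _ _ y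
    _ = s⁻¹ * r ^ (n * (m / n) + n) := by
        rw [pow_add, pow_mul, hrn]
        field_simp
    _ ≤ s⁻¹ * r ^ m := by
        gcongr ?_ * ?_
        exact pow_le_pow_of_le_one hr0.le hr1 (by omega)

/-! ### Step functions as integer certificates. -/

/-- The largest of the entries `g_lo, …, g_(hi-1)`. -/
def sliceMax (g : List ℕ) (lo hi : ℕ) : ℕ := ((g.drop lo).take (hi - lo)).foldr max 0

theorem le_foldr_max {l : List ℕ} {x : ℕ} (hx : x ∈ l) : x ≤ l.foldr max 0 := by
  induction l with
  | nil => simp at hx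
  | cons y l ih =>
    rcases List.mem_cons.1 hx with rfl | h
    · exact le_max_left _ _
    · exact (ih h).trans (le_max_right _ _)

theorem getD_le_sliceMax (g : List ℕ) {lo hi j : ℕ} (h₁ : lo ≤ j) (h₂ : j < hi) :
    g.getD j 0 ≤ sliceMax g lo hi := by
  rcases lt_or_ge j g.length with hj | hj
  · apply le_foldr_max
    rw [List.mem_take_iff_getElem]
    refine ⟨j - lo, by simp only [List.length_drop]; omega, ?_⟩
    rw [List.getElem_drop, List.getD_eq_getElem _ _ hj]
    congr 1
    omega
  · simp [List.getD_eq_getElem?_getD, List.getElem?_eq_none hj]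

/-- Checks that the step function on `[0,1]` with mesh `1/M` and values `g` is positive and
satisfies `g (y/ρ) + g ((y-(1-ρ))/ρ) ≤ p/1000 * g y` for every `ρ ∈ [a/1000, b/1000]`. -/
def checkCell (M a b p : ℕ) (g : List ℕ) : Bool :=
  decide (0 < a) && (List.range (M + 1)).all fun i =>
    decide (0 < g.getD i 0) &&
    decide ((sliceMax g (i * 1000 / b) (((i + 1) * 1000 + a - 1) / a) +
      sliceMax g ((M * a + i * 1000 - M * 1000) / a)
        ((M * b + (i + 1) * 1000 - M * 1000 + b - 1) / b)) * 1000 ≤ p * g.getD i 0)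

/-- The step function on `[0,1]` with mesh `1/M` and values `g`, extended by zero. -/
noncomputable def stepFun (M : ℕ) (g : List ℕ) (y : ℝ) : ℝ :=
  (Set.Icc (0 : ℝ) 1).indicator (fun y => (g.getD ⌊M * y⌋₊ 0 : ℝ)) y

theorem stepFun_le {M : ℕ} {g : List ℕ} {z : ℝ} {lo hi : ℕ}
    (h : 0 ≤ z → z ≤ 1 → lo ≤ ⌊M * z⌋₊ ∧ ⌊M * z⌋₊ < hi) :
    stepFun M g z ≤ sliceMax g lo hi := by
  by_cases hz : z ∈ Set.Icc (0 : ℝ) 1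
  · obtain ⟨h₁, h₂⟩ := h hz.1 hz.2
    simpa [stepFun, hz] using getD_le_sliceMax g h₁ h₂
  · simp [stepFun, hz]

theorem lt_add_sub_one_div {a j X : ℕ} (ha : 0 < a) (h : j * a < X) : j < (X + a - 1) / a := by
  rw [Nat.lt_iff_add_one_le, Nat.le_div_iff_mul_le ha]
  have : (j + 1) * a = j * a + a := by ring
  omega

/-- When `y` ranges over a mesh cell and `ρ` over its interval, the cell of each preimage is known
only up to a range of indices. The extreme indices come from the endpoints `a`, `b`, and the maximum
over the range bounds the value. -/
theorem stepFun_superharmonic {M a b p : ℕ} {g : List ℕ} (hc : checkCell M a b p g = true)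
    {ρ : ℝ} (h₁ : (a : ℝ) / 1000 ≤ ρ) (h₂ : ρ ≤ b / 1000) {y : ℝ}
    (hy : y ∈ Set.Icc (0 : ℝ) 1) :
    1 ≤ stepFun M g y ∧
      stepFun M g (y / ρ) + stepFun M g ((y - (1 - ρ)) / ρ) ≤ p / 1000 * stepFun M g y := by
  simp only [checkCell, Bool.and_eq_true, decide_eq_true_eq, List.all_eq_true, List.mem_range] at hc
  obtain ⟨ha, hc⟩ := hc
  have ha' : (0 : ℝ) < a := by exact_mod_cast ha
  have hρ : 0 < ρ := (by positivity : (0 : ℝ) < a / 1000).trans_le h₁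
  have haρ : (a : ℝ) ≤ 1000 * ρ := by linarith
  have hbρ : 1000 * ρ ≤ b := by linarith
  have hb : 0 < b := by
    have : (0 : ℝ) < b := by linarith
    exact_mod_cast this
  have hM : (0 : ℝ) ≤ M := M.cast_nonneg
  set i := ⌊M * y⌋₊ with hi
  have hiy : (i : ℝ) ≤ M * y := Nat.floor_le (mul_nonneg hM hy.1)
  have hyi : M * y < i + 1 := Nat.lt_floor_add_one _
  have hiM : i < M + 1 := by
    have : (i : ℝ) ≤ M := hiy.trans (mul_le_of_le_one_right hM hy.2)
    exact Nat.lt_succ_of_le (by exact_mod_cast this)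
  obtain ⟨hpos, hle⟩ := hc i hiM
  have hval : stepFun M g y = (g.getD i 0 : ℝ) := by simp [stepFun, hy, hi]
  rw [hval]
  refine ⟨by exact_mod_cast hpos, ?_⟩
  have hA : stepFun M g (y / ρ) ≤
      sliceMax g (i * 1000 / b) (((i + 1) * 1000 + a - 1) / a) := by
    refine stepFun_le fun hz _ => ?_
    set z := y / ρ with hzdef
    have hzy : z * ρ = y := div_mul_cancel₀ _ hρ.ne'
    have hMz : (M : ℝ) * y = M * z * ρ := by rw [mul_assoc, hzy]
    set j := ⌊M * z⌋₊
    have hMz0 : 0 ≤ M * z := mul_nonneg hM hz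
    have hj : (j : ℝ) ≤ M * z := Nat.floor_le hMz0
    have hj' : M * z < j + 1 := Nat.lt_floor_add_one _
    constructor
    · rw [← Nat.lt_succ_iff, Nat.div_lt_iff_lt_mul hb]
      have : (i : ℝ) * 1000 < (j + 1) * b := by
        have : M * z * (1000 * ρ) ≤ M * z * b := mul_le_mul_of_nonneg_left hbρ hMz0
        have : M * z * b < (j + 1) * b := mul_lt_mul_of_pos_right hj' (by exact_mod_cast hb)
        linarith
      exact_mod_cast this
    · apply lt_add_sub_one_div ha
      have : (j : ℝ) * a < (i + 1) * 1000 := by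
        have : (j : ℝ) * a ≤ M * z * a := mul_le_mul_of_nonneg_right hj ha'.le
        have : M * z * a ≤ M * z * (1000 * ρ) := mul_le_mul_of_nonneg_left haρ hMz0
        linarith
      exact_mod_cast this
  have hB : stepFun M g ((y - (1 - ρ)) / ρ) ≤
      sliceMax g ((M * a + i * 1000 - M * 1000) / a)
        ((M * b + (i + 1) * 1000 - M * 1000 + b - 1) / b) := by
    refine stepFun_le fun hz hz1 => ?_
    set z := (y - (1 - ρ)) / ρ with hzdef
    have hzy : z * ρ = y - (1 - ρ) := div_mul_cancel₀ _ hρ.ne'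
    -- Distances are measured from the fixed point `1` of the second map, so `a` and `b` swap roles
    -- compared with `hA`.
    have hMz : (M : ℝ) * y = M - (M - M * z) * ρ := by linear_combination (-M : ℝ) * hzy
    set k := ⌊M * z⌋₊
    have hw0 : 0 ≤ M - M * z := sub_nonneg.2 (mul_le_of_le_one_right hM hz1)
    have hk : (k : ℝ) ≤ M * z := Nat.floor_le (mul_nonneg hM hz)
    have hk' : M * z < k + 1 := Nat.lt_floor_add_one _
    constructor
    · rw [← Nat.lt_succ_iff, Nat.div_lt_iff_lt_mul ha]
      have : (M : ℝ) * a + i * 1000 < (k + 1) * a + M * 1000 := by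
        have : (M - M * z) * a ≤ (M - M * z) * (1000 * ρ) :=
          mul_le_mul_of_nonneg_left haρ hw0
        have : M * z * a < (k + 1) * a := mul_lt_mul_of_pos_right hk' ha'
        linarith
      have : M * a + i * 1000 < (k + 1) * a + M * 1000 := by exact_mod_cast this
      -- Covers the case where the truncated subtraction in the lower index gives `0`.
      have : 0 < (k + 1) * a := by positivity
      rw [Nat.succ_eq_add_one]
      omega
    · apply lt_add_sub_one_div hb
      have : (k : ℝ) * b + M * 1000 < M * b + (i + 1) * 1000 := by
        have : (M - M * z) * (1000 * ρ) ≤ (M - M * z) * b :=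
          mul_le_mul_of_nonneg_left hbρ hw0
        have : (k : ℝ) * b ≤ M * z * b := mul_le_mul_of_nonneg_right hk b.cast_nonneg
        linarith
      have : k * b + M * 1000 < M * b + (i + 1) * 1000 := by exact_mod_cast this
      omega
  refine (add_le_add hA hB).trans ?_
  have := (Nat.cast_le (α := ℝ)).2 hle
  push_cast at this
  linarith

theorem stepFun_nonneg (M : ℕ) (g : List ℕ) (y : ℝ) : 0 ≤ stepFun M g y :=
  Set.indicator_nonneg (fun _ _ => Nat.cast_nonneg _) y

/-- Comparison principle: the averaging operator preserves the inequality, and its factor `1/2`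
turns `p/1000` into `p/2000`. -/
theorem N_le_stepFun {M a b p : ℕ} {g : List ℕ} (hc : checkCell M a b p g = true)
    {ρ : ℝ} (h0 : 0 < ρ) (h1 : ρ < 1) (h₁ : (a : ℝ) / 1000 ≤ ρ) (h₂ : ρ ≤ b / 1000)
    (n : ℕ) (y : ℝ) : N ρ n y ≤ (p / 2000 : ℝ) ^ n * stepFun M g y := by
  induction n generalizing y with
  | zero =>
    by_cases hy : y ∈ Set.Icc (0 : ℝ) 1
    · simpa [N_zero, hy] using (stepFun_superharmonic hc h₁ h₂ hy).1
    · simp [N_zero, hy, stepFun_nonneg]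
  | succ n ih =>
    by_cases hy : y ∈ Set.Icc (0 : ℝ) 1
    · rw [N_succ h0.ne', pow_succ]
      have hpow : (0 : ℝ) ≤ (p / 2000) ^ n := by positivity
      have := mul_le_mul_of_nonneg_left (stepFun_superharmonic hc h₁ h₂ hy).2 hpow
      linarith [ih (y / ρ), ih ((y - (1 - ρ)) / ρ)]
    · rw [N_eq_zero h0 h1.le _ hy]
      exact mul_nonneg (by positivity) (stepFun_nonneg M g y)

theorem exists_N_le_of_checkCell {M a b p u v : ℕ} {g : List ℕ}
    (hc : checkCell M a b p g = true) (hv : v ≠ 0) (hp : p ^ v * 1000 ^ u ≤ a ^ u * 2000 ^ v)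
    {ρ : ℝ} (h0 : 0 < ρ) (h1 : ρ < 1) (h₁ : (a : ℝ) / 1000 ≤ ρ) (h₂ : ρ ≤ b / 1000) :
    ∃ C : ℝ, 0 < C ∧ ∀ n y, N ρ n y ≤ C * (ρ ^ ((u : ℝ) / v)) ^ n := by
  have hv' : (v : ℝ) ≠ 0 := by exact_mod_cast hv
  have hrate : (p / 2000 : ℝ) ≤ ρ ^ ((u : ℝ) / v) := by
    -- Taking `v`-th powers turns `p/2000 ≤ (a/1000)^(u/v)` into the integer inequality `hp`; the
    -- left endpoint `a` is the worst case.
    refine (pow_le_pow_iff_left₀ (by positivity) (Real.rpow_nonneg h0.le _) hv).1 ?_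
    rw [← Real.rpow_natCast (ρ ^ _), ← Real.rpow_mul h0.le, div_mul_cancel₀ _ hv',
      Real.rpow_natCast]
    refine le_trans ?_ (pow_le_pow_left₀ (by positivity) h₁ u)
    rw [div_pow, div_pow, div_le_div_iff₀ (by positivity) (by positivity)]
    exact_mod_cast hp
  refine ⟨sliceMax g 0 (M + 1) + 1, by positivity, fun n y => ?_⟩
  have hG : stepFun M g y ≤ sliceMax g 0 (M + 1) :=
    stepFun_le fun _ hz => ⟨Nat.zero_le _, Nat.lt_succ_of_le
      (Nat.floor_le_of_le (mul_le_of_le_one_right M.cast_nonneg hz))⟩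
  calc N ρ n y ≤ (p / 2000 : ℝ) ^ n * stepFun M g y := N_le_stepFun hc h0 h1 h₁ h₂ n y
    _ ≤ (ρ ^ ((u : ℝ) / v)) ^ n * (sliceMax g 0 (M + 1) + 1) := by
        have := stepFun_nonneg M g y
        gcongr
        linarith
    _ = _ := mul_comm _ _

/-- Checks a chain of step functions, one for each of the consecutive intervals of parameters
`[a/1000, b/1000]` ending at the listed values of `b` and covering everything up to `hi/1000`. A
step function is symmetric about `1/2` and given by its values on `[0,1/2]`. -/
def checkChain (u v hi : ℕ) : ℕ → List (ℕ × ℕ × List ℕ) → Bool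
  | _, [] => false
  | a, (b, p, l) :: cs =>
    -- The extra entry is the value at the single point `y = 1`, whose index is `M`.
    checkCell (2 * l.length) a b p (l ++ l.reverse ++ [40]) &&
      decide (p ^ v * 1000 ^ u ≤ a ^ u * 2000 ^ v) && (decide (hi ≤ b) || checkChain u v hi b cs)

theorem exists_N_le_of_checkChain {u v hi : ℕ} (hv : v ≠ 0) {ρ : ℝ} (h0 : 0 < ρ) (h1 : ρ < 1)
    (hhi : ρ ≤ hi / 1000) {a : ℕ} (ha : (a : ℝ) / 1000 ≤ ρ) {cs : List (ℕ × ℕ × List ℕ)}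
    (hc : checkChain u v hi a cs = true) :
    ∃ C : ℝ, 0 < C ∧ ∀ n y, N ρ n y ≤ C * (ρ ^ ((u : ℝ) / v)) ^ n := by
  induction cs generalizing a with
  | nil => simp [checkChain] at hc
  | cons c cs ih =>
    obtain ⟨b, p, l⟩ := c
    simp only [checkChain, Bool.and_eq_true, Bool.or_eq_true, decide_eq_true_eq] at hc
    obtain ⟨⟨hcell, hp⟩, hrest⟩ := hc
    rcases le_total ρ (b / 1000) with hb | hb
    · exact exists_N_le_of_checkCell hcell hv hp h0 h1 ha hb
    · rcases hrest with h | h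
      · refine exists_N_le_of_checkCell hcell hv hp h0 h1 ha (hhi.trans ?_)
        gcongr
      · exact ih hb h

theorem le_lowerLocalDim_of_checkChain {u v lo hi : ℕ} {cs : List (ℕ × ℕ × List ℕ)}
    (hc : checkChain u v hi lo cs = true) (hv : v ≠ 0) {ρ : ℝ} (h0 : 0 < ρ) (h1 : ρ < 1)
    {μ : Measure ℝ} (hμ : IsUnbiasedBernoulliConvolution ρ μ) (hsep : AsymptoticallyWSC ρ) {x : ℝ}
    (hx : x ∈ Set.Icc (0 : ℝ) 1) {l h d : ℝ} (hρ : ρ ∈ Set.Icc l h) (hl : l = lo / 1000)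
    (hh : h = hi / 1000) (hd : d ≤ u / v) : (d : EReal) ≤ lowerLocalDim μ x := by
  obtain ⟨C, hC, hN⟩ := exists_N_le_of_checkChain hv h0 h1 (hh ▸ hρ.2) (hl ▸ hρ.1) hc
  refine le_trans ?_ (le_lowerLocalDim_of_N_le h0 h1 hμ hsep hx hC hN)
  exact_mod_cast hd

/-! ### Certificates for the seven parameter ranges. -/

/-- Step functions for the parameters in `[500/1000, 550/1000]`. -/
def chain_500_550 : List (ℕ × ℕ × List ℕ) :=
  [(515, 1148, [47, 53, 56, 60, 60, 64, 68, 68, 53, 60, 60, 73, 78, 78, 73, 60, 60, 53, 68, 68,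
  68, 60, 60, 83, 89, 89, 89, 83, 60, 60, 68, 68, 68, 60, 60, 60, 78, 78, 78, 78, 60, 60, 64, 68,
  68, 68, 60, 95, 101, 102]), (530, 1176, [51, 59, 61, 69, 69, 71, 80, 80, 75, 69, 69, 83, 94, 94,
  94, 88, 69, 69, 75, 80, 80, 80, 69, 97, 108, 110, 110, 110, 103, 69, 80, 80, 80, 80, 69, 69, 88,
  94, 94, 94, 92, 69, 69, 80, 80, 80, 114, 121, 127, 129]), (545, 1203, [40, 40, 40, 40, 40, 40,
  46, 46, 46, 46, 40, 40, 55, 55, 55, 55, 55, 40, 40, 46, 46, 46, 46, 66, 66, 66, 66, 66, 66, 66,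
  66, 46, 46, 46, 46, 40, 55, 55, 55, 55, 55, 55, 40, 46, 79, 79, 79, 79, 77, 77]), (550, 1230,
  [40, 40, 40, 40, 40, 40, 40, 40, 40, 40, 40, 40, 48, 48, 48, 48, 48, 48, 40, 40, 40, 40, 40, 59,
  59, 59, 59, 59, 59, 59, 59, 40, 40, 40, 40, 40, 40, 48, 48, 48, 48, 48, 48, 40, 72, 72, 72, 72,
  72, 66])]

/-- The exponent `4/5` exceeds the required `0.792021`. Each later range likewise uses a fraction
with small denominator just above its decimal, keeping the integer powers small. -/
theorem chain_500_550_valid : checkChain 4 5 550 500 chain_500_550 = true := by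
  decide +kernel

/-- Step functions for the parameters in `[550/1000, 600/1000]`. -/
def chain_550_600 : List (ℕ × ℕ × List ℕ) :=
  [(558, 1215, [40, 40, 40, 48, 48, 48, 47, 58, 58, 58, 56, 48, 56, 67, 70, 70, 70, 67, 48, 48,
  58, 58, 58, 67, 81, 81, 85, 85, 85, 85, 81, 67, 58, 58, 58, 56, 48, 67, 70, 70, 70, 70, 67, 81,
  81, 98, 98, 98, 103, 96]), (570, 1229, [68, 83, 85, 102, 104, 104, 110, 125, 127, 127, 127, 104,
  134, 153, 153, 156, 156, 156, 141, 124, 115, 127, 127, 164, 164, 187, 188, 191, 191, 191, 188,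
  173, 164, 152, 127, 125, 124, 141, 153, 156, 156, 156, 186, 201, 187, 212, 229, 231, 231, 234]),
  (584, 1251, [40, 40, 40, 42, 44, 44, 44, 52, 55, 55, 55, 52, 52, 64, 64, 68, 68, 68, 64, 64, 64,
  52, 55, 80, 80, 80, 80, 85, 85, 85, 80, 80, 80, 80, 80, 55, 52, 64, 64, 68, 68, 100, 100, 100,
  100, 93, 99, 99, 99, 106]), (600, 1277, [40, 40, 40, 40, 40, 40, 40, 40, 40, 40, 40, 40, 51, 51,
  51, 51, 51, 51, 51, 51, 51, 51, 65, 65, 65, 65, 65, 65, 65, 63, 65, 65, 65, 65, 65, 65, 65, 51,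
  51, 83, 83, 83, 83, 83, 83, 83, 83, 80, 80, 80])]

theorem chain_550_600_valid : checkChain 5 6 600 550 chain_550_600 = true := by
  decide +kernel

/-- Step functions for the parameters in `[600/1000, 650/1000]`. -/
def chain_600_650 : List (ℕ × ℕ × List ℕ) :=
  [(626, 1298, [75, 97, 113, 125, 146, 162, 162, 181, 189, 210, 210, 210, 210, 234, 245, 259, 272,
  272, 272, 272, 272, 272, 301, 303, 318, 335, 335, 353, 353, 353, 351, 353, 353, 353, 349, 335,
  353, 364, 390, 393, 397, 412, 418, 434, 434, 453, 458, 455, 443, 420]), (645, 1345, [40, 40, 40,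
  44, 44, 56, 59, 59, 73, 75, 76, 79, 79, 92, 98, 100, 101, 101, 105, 105, 105, 123, 123, 131,
  131, 134, 135, 135, 134, 134, 141, 141, 141, 134, 164, 165, 165, 168, 176, 175, 180, 180, 181,
  174, 178, 180, 176, 179, 178, 189]), (650, 1380, [40, 40, 40, 40, 40, 40, 40, 40, 41, 43, 43,
  43, 45, 56, 58, 58, 59, 59, 58, 62, 62, 77, 77, 79, 80, 81, 81, 80, 76, 76, 84, 85, 85, 85, 105,
  105, 108, 109, 110, 109, 111, 110, 109, 103, 104, 104, 101, 104, 115, 116])]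

theorem chain_600_650_valid : checkChain 11 13 650 600 chain_600_650 = true := by
  decide +kernel

/-- Step functions for the parameters in `[650/1000, 700/1000]`. -/
def chain_650_700 : List (ℕ × ℕ × List ℕ) :=
  [(670, 1396, [40, 40, 40, 43, 43, 55, 59, 59, 69, 76, 81, 81, 81, 96, 100, 106, 112, 112, 112,
  112, 134, 134, 134, 139, 147, 153, 155, 155, 155, 155, 155, 159, 187, 187, 187, 185, 194, 197,
  204, 213, 211, 215, 213, 215, 215, 215, 210, 208, 211, 221]), (691, 1432, [40, 51, 72, 78, 102,
  111, 140, 146, 158, 174, 200, 209, 214, 226, 248, 260, 285, 298, 306, 306, 323, 338, 355, 372,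
  396, 408, 426, 437, 437, 437, 454, 462, 484, 501, 507, 532, 537, 566, 583, 595, 610, 625, 624,
  609, 601, 591, 610, 600, 615, 611]), (700, 1469, [40, 40, 40, 40, 40, 40, 40, 40, 47, 47, 47,
  52, 52, 68, 68, 69, 71, 76, 76, 76, 99, 99, 100, 100, 103, 104, 111, 111, 111, 139, 144, 144,
  144, 146, 146, 151, 151, 152, 152, 163, 158, 163, 163, 156, 171, 171, 170, 169, 174, 171])]

theorem chain_650_700_valid : checkChain 5 6 700 650 chain_650_700 = true := by
  decide +kernel

/-- Step functions for the parameters in `[700/1000, 750/1000]`. -/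
def chain_700_750 : List (ℕ × ℕ × List ℕ) :=
  [(730, 1520, [40, 44, 66, 70, 99, 106, 126, 149, 161, 191, 198, 225, 244, 260, 290, 300, 325,
  341, 370, 395, 410, 440, 455, 474, 494, 518, 552, 562, 600, 623, 641, 668, 691, 716, 720, 750,
  761, 787, 799, 810, 845, 841, 847, 868, 858, 889, 871, 889, 896, 895]), (750, 1569, [40, 40, 40,
  40, 40, 40, 40, 40, 48, 52, 55, 60, 75, 81, 83, 85, 94, 117, 118, 127, 129, 133, 144, 146, 183,
  185, 185, 199, 202, 208, 208, 225, 229, 234, 247, 249, 250, 271, 271, 276, 280, 285, 285, 300,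
  300, 303, 306, 306, 303, 307])]

theorem chain_700_750_valid : checkChain 10 13 750 700 chain_700_750 = true := by
  decide +kernel

/-- Step functions for the parameters in `[750/1000, 800/1000]`. -/
def chain_750_800 : List (ℕ × ℕ × List ℕ) :=
  [(785, 1650, [40, 40, 40, 40, 40, 40, 53, 56, 70, 87, 91, 115, 128, 142, 150, 189, 204, 211,
  234, 247, 295, 311, 336, 348, 377, 385, 407, 446, 465, 472, 514, 533, 545, 582, 595, 615, 626,
  665, 680, 687, 705, 720, 737, 749, 740, 770, 767, 780, 785, 783]), (800, 1701, [40, 40, 40, 40,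
  40, 40, 40, 40, 40, 40, 40, 40, 40, 40, 59, 61, 66, 68, 74, 100, 103, 112, 115, 116, 125, 130,
  135, 144, 150, 155, 157, 172, 179, 180, 189, 204, 214, 221, 222, 227, 233, 238, 237, 236, 246,
  246, 246, 252, 260, 261])]

theorem chain_750_800_valid : checkChain 2 3 800 750 chain_750_800 = true := by
  decide +kernel

/-- Step functions for the parameters in `[800/1000, 851/1000]`. -/
def chain_800_851 : List (ℕ × ℕ × List ℕ) :=
  [(851, 1817, [40, 40, 40, 40, 40, 40, 40, 40, 43, 56, 62, 78, 101, 112, 140, 155, 183, 202, 213,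
  241, 281, 292, 327, 347, 397, 432, 469, 486, 537, 568, 594, 643, 672, 712, 728, 763, 792, 830,
  865, 887, 901, 928, 966, 975, 989, 998, 1007, 1021, 1033, 1043])]

theorem chain_800_851_valid : checkChain 3 7 851 800 chain_800_851 = true := by
  decide +kernel

end BernoulliConv

theorem mainTheorem7 (ρ : ℝ) (hρ : ρ ∈ Set.Ico (1 / 2 : ℝ) 1) (μ : Measure ℝ)
    (hμ : BernoulliConv.IsUnbiasedBernoulliConvolution ρ μ)
    (hsep : BernoulliConv.AsymptoticallyWSC ρ) (x : ℝ) (hx : x ∈ Set.Icc (0 : ℝ) 1) :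
    (ρ ∈ Set.Icc (0.50 : ℝ) 0.55 →
      ((0.792021 : ℝ) : EReal) ≤ BernoulliConv.lowerLocalDim μ x) ∧
    (ρ ∈ Set.Icc (0.55 : ℝ) 0.60 →
      ((0.825663 : ℝ) : EReal) ≤ BernoulliConv.lowerLocalDim μ x) ∧
    (ρ ∈ Set.Icc (0.60 : ℝ) 0.65 →
      ((0.840348 : ℝ) : EReal) ≤ BernoulliConv.lowerLocalDim μ x) ∧
    (ρ ∈ Set.Icc (0.65 : ℝ) 0.70 →
      ((0.824701 : ℝ) : EReal) ≤ BernoulliConv.lowerLocalDim μ x) ∧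
    (ρ ∈ Set.Icc (0.70 : ℝ) 0.75 →
      ((0.750984 : ℝ) : EReal) ≤ BernoulliConv.lowerLocalDim μ x) ∧
    (ρ ∈ Set.Icc (0.75 : ℝ) 0.80 →
      ((0.635012 : ℝ) : EReal) ≤ BernoulliConv.lowerLocalDim μ x) ∧
    (ρ ∈ Set.Icc (0.80 : ℝ) 0.851 →
      ((0.416226 : ℝ) : EReal) ≤ BernoulliConv.lowerLocalDim μ x) ∧
    (∀ n : ℕ, 1 ≤ n → n ≤ 10 →
      ((Real.log (⨆ y : Set.Icc (0 : ℝ) 1, BernoulliConv.N ρ n y) / (n * Real.log ρ) : ℝ) : EReal)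
        ≤ BernoulliConv.lowerLocalDim μ x) := by
  have h0 : 0 < ρ := one_half_pos.trans_le hρ.1
  have h1 : ρ < 1 := hρ.2
  open BernoulliConv in
  refine ⟨fun h => ?_, fun h => ?_, fun h => ?_, fun h => ?_, fun h => ?_, fun h => ?_,
    fun h => ?_, fun n hn _ => log_iSup_N_le_lowerLocalDim h0 h1 hμ hsep hx (by omega)⟩
  · exact BernoulliConv.le_lowerLocalDim_of_checkChain BernoulliConv.chain_500_550_valid (by norm_num)
      h0 h1 hμ hsep hx h (by norm_num) (by norm_num) (by norm_num)
  · exact BernoulliConv.le_lowerLocalDim_of_checkChain BernoulliConv.chain_550_600_valid (by norm_num)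
      h0 h1 hμ hsep hx h (by norm_num) (by norm_num) (by norm_num)
  · exact BernoulliConv.le_lowerLocalDim_of_checkChain BernoulliConv.chain_600_650_valid (by norm_num)
      h0 h1 hμ hsep hx h (by norm_num) (by norm_num) (by norm_num)
  · exact BernoulliConv.le_lowerLocalDim_of_checkChain BernoulliConv.chain_650_700_valid (by norm_num)
      h0 h1 hμ hsep hx h (by norm_num) (by norm_num) (by norm_num)
  · exact BernoulliConv.le_lowerLocalDim_of_checkChain BernoulliConv.chain_700_750_valid (by norm_num)
      h0 h1 hμ hsep hx h (by norm_num) (by norm_num) (by norm_num)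
  · exact BernoulliConv.le_lowerLocalDim_of_checkChain BernoulliConv.chain_750_800_valid (by norm_num)
      h0 h1 hμ hsep hx h (by norm_num) (by norm_num) (by norm_num)
  · exact BernoulliConv.le_lowerLocalDim_of_checkChain BernoulliConv.chain_800_851_valid (by norm_num)
      h0 h1 hμ hsep hx h (by norm_num) (by norm_num) (by norm_num)
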